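/- Theorem. Let $n\ge 0$ and let $M:=\mathbb{C}^n/2\pi i\,\mathbb{Z}^n\simeq(\mathbb{C}^*)^n$, with coordinates $z=x+iy$ and with the action of $\mathbb{T}^n=\mathbb{R}^n/2\pi\mathbb{Z}^n$ given by $[\theta]\cdot[z]=[z+i\theta]$. Let $g$ be a (smooth) Kähler metric on $M$ with Kähler form $\omega(\cdot,\cdot)=g(J\cdot,\cdot)$, such that the $\mathbb{T}^n$-action is Hamiltonian, i.e. there is a $\mathbb{T}^n$-invariant map $\mu:M\to(\mathbb{R}^n)^*$ with $d(\mu\cdot X)=\omega(\tilde X,\cdot)$ for every $X\in\mathbb{R}^n=\mathrm{Lie}(\mathbb{T}^n)$, where $\tilde X$ is the fundamental vector field of $X$. Let $\mathrm{Ric}$ be the Ricci tensor of $g$. For $x\in\mathbb{R}^n$ let $\mathrm{Vol}(x)$ be the Riemannian volume of the canonical $n$-torus $\{[x+iy]:y\in\mathbb{R}^n\}$ with respect to the metric induced by $g$. Convexity, concavity and affinity below refer to functions of the variable $x\in\mathbb{R}^n$ (so $x_j=\log r_j$ in terms of the radii $r_j$ on $(\mathbb{C}^*)^n$). Then: 1.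 $\mathrm{Ric}\le 0$ on $M$ if and only if $\log\mathrm{Vol}$ is convex on $\mathbb{R}^n$; and $\mathrm{Ric}\le 0$ implies that $\mathrm{Vol}$ is convex. 2. $\mathrm{Ric}\ge 0$ on $M$ if and only if $\log\mathrm{Vol}$ is concave on $\mathbb{R}^n$; and $\mathrm{Ric}\ge 0$ implies that $1/\mathrm{Vol}$ is convex. 3. If $\mathrm{Ric}=0$ on $M$, then $\log\mathrm{Vol}$ is linear in the affine sense: there are a linear functional $L$ on $\mathbb{R}^n$ and a constant $c$ with $\log\mathrm{Vol}(x)=L(x)+c$ for all $x\in\mathbb{R}^n$. -/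

import Mathlib

open scoped ContDiff

noncomputable section

namespace KahlerTorus

/-- The lattice `2πi ℤⁿ` in `ℂⁿ`. -/
def complexLattice (n : ℕ) : AddSubgroup (Fin n → ℂ) :=
  AddSubgroup.pi Set.univ fun _ => AddSubgroup.zmultiples (2 * (Real.pi : ℂ) * Complex.I)

/-- The lattice `2π ℤⁿ` in `ℝⁿ`. -/
def realLattice (n : ℕ) : AddSubgroup (Fin n → ℝ) :=
  AddSubgroup.pi Set.univ fun _ => AddSubgroup.zmultiples (2 * Real.pi)

/-- The complex Lie group `M = ℂⁿ / 2πi ℤⁿ ≃ (ℂ*)ⁿ` (the isomorphism is `z ↦ exp z`).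
The quotient map `ℂⁿ → M` is the universal cover, and its local inverses are the holomorphic
charts of `M`; the coordinate frame trivialises the tangent bundle, so every tangent space of `M`
is `ℂⁿ`, with complex structure `J v = Complex.I • v`. -/
abbrev M (n : ℕ) : Type := (Fin n → ℂ) ⧸ complexLattice n

/-- The compact torus `𝕋ⁿ = ℝⁿ / 2π ℤⁿ`, with Lie algebra `ℝⁿ`. -/
abbrev Torus (n : ℕ) : Type := (Fin n → ℝ) ⧸ realLattice n

/-- The additive map `θ ↦ iθ` from `ℝⁿ` to `ℂⁿ`. -/
def imaginary (n : ℕ) : (Fin n → ℝ) →+ (Fin n → ℂ) where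
  toFun θ := fun j => (θ j : ℂ) * Complex.I
  map_zero' := by ext j; simp
  map_add' a b := by ext j; simp [add_mul]

theorem realLattice_le (n : ℕ) :
    realLattice n ≤ (complexLattice n).comap (imaginary n) := by
  intro θ hθ
  rw [AddSubgroup.mem_comap]
  simp only [realLattice, complexLattice, AddSubgroup.mem_pi, AddSubgroup.mem_zmultiples_iff]
    at hθ ⊢
  intro j hj
  obtain ⟨k, hk⟩ := hθ j hj
  refine ⟨k, ?_⟩
  simp only [imaginary, AddMonoidHom.coe_mk, ZeroHom.coe_mk, ← hk]
  push_cast [zsmul_eq_mul]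
  ring

/-- The inclusion `𝕋ⁿ → M`, `[θ] ↦ [iθ]`. -/
def torusHom (n : ℕ) : Torus n →+ M n :=
  QuotientAddGroup.map (realLattice n) (complexLattice n) (imaginary n) (realLattice_le n)

/-- The standard action of `𝕋ⁿ` on `M`: `[θ] · [z] = [z + iθ]`, that is,
`w ↦ (e^{iθ₁} w₁, …, e^{iθₙ} wₙ)` on `(ℂ*)ⁿ`. -/
def rotate {n : ℕ} (t : Torus n) (p : M n) : M n := torusHom n t + p

/-- The fundamental vector field of `X ∈ ℝⁿ = Lie(𝕋ⁿ)`: it is the constant field `iX`. -/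
def fundamentalField {n : ℕ} (X : Fin n → ℝ) : Fin n → ℂ := imaginary n X

/-- In the coordinates of `ℂⁿ`, the orbit of the one-parameter group generated by `X`
is the line with velocity `fundamentalField X`. -/
theorem rotate_coe {n : ℕ} (X : Fin n → ℝ) (s : ℝ) (z : Fin n → ℂ) :
    rotate ((s • X : Fin n → ℝ) : Torus n) (z : M n) =
      ((z + s • fundamentalField X : Fin n → ℂ) : M n) := by
  have h : imaginary n (s • X) = s • fundamentalField X := by
    ext j; simp [fundamentalField, imaginary, mul_assoc]
  rw [add_comm z, ← h]
  rfl

/-- A smooth Riemannian metric on `M`. -/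
structure RiemannianMetric (n : ℕ) where
  /-- the inner product on each tangent space -/
  inner : M n → (Fin n → ℂ) →L[ℝ] (Fin n → ℂ) →L[ℝ] ℝ
  smooth : ContDiff ℝ ∞ fun z : Fin n → ℂ => inner (z : M n)
  symm : ∀ p v w, inner p v w = inner p w v
  pos : ∀ p v, v ≠ 0 → 0 < inner p v v

namespace RiemannianMetric

variable {n : ℕ} (g : RiemannianMetric n)

/-- The fundamental 2-form `ω(v, w) = g(Jv, w)`, equivalently `g(v, w) = ω(v, Jw)` when
`g` is `J`-invariant. -/
def omega (p : M n) (v : Fin n → ℂ) : (Fin n → ℂ) →L[ℝ] ℝ := g.inner p (Complex.I • v)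

/-- `g` is Kähler: it is `J`-invariant and `dω = 0` (`dω` is evaluated on triples of constant
vector fields on `ℂⁿ`, which commute). -/
structure IsKahler : Prop where
  hermitian : ∀ p v w, g.inner p (Complex.I • v) (Complex.I • w) = g.inner p v w
  closed : ∀ z u v w : Fin n → ℂ,
    fderiv ℝ (fun ζ : Fin n → ℂ => g.omega (ζ : M n) v w) z u
      + fderiv ℝ (fun ζ : Fin n → ℂ => g.omega (ζ : M n) w u) z v
      + fderiv ℝ (fun ζ : Fin n → ℂ => g.omega (ζ : M n) u v) z w = 0

/-- `μ : M → (ℝⁿ)*` is a moment map for the `𝕋ⁿ`-action: `d(μ·X) = ω(X̃, ·)` for every `X` in the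
Lie algebra, and `μ` is equivariant. The coadjoint action of the abelian group `𝕋ⁿ` is trivial, so
equivariance is invariance. -/
structure IsMomentMap (μ : M n → (Fin n → ℝ) →ₗ[ℝ] ℝ) : Prop where
  deriv : ∀ (X : Fin n → ℝ) (z : Fin n → ℂ),
    HasFDerivAt (fun ζ : Fin n → ℂ => μ (ζ : M n) X)
      (g.omega (z : M n) (fundamentalField X)) z
  equivariant : ∀ (t : Torus n) (p : M n), μ (rotate t p) = μ p

/-- The `𝕋ⁿ`-action on `M` is Hamiltonian with respect to `ω`. -/
def IsHamiltonian : Prop := ∃ μ : M n → (Fin n → ℝ) →ₗ[ℝ] ℝ, g.IsMomentMap μ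

/-- The real coordinate frame `∂x₁, …, ∂xₙ, ∂y₁, …, ∂yₙ`, where `z = x + iy`. -/
def frame {n : ℕ} : Fin n ⊕ Fin n → (Fin n → ℂ)
  | Sum.inl j => Pi.single j 1
  | Sum.inr j => Pi.single j Complex.I

/-- The components of a tangent vector in the frame `∂x₁, …, ∂xₙ, ∂y₁, …, ∂yₙ`. -/
def component {n : ℕ} (v : Fin n → ℂ) : Fin n ⊕ Fin n → ℝ
  | Sum.inl j => (v j).re
  | Sum.inr j => (v j).im

/-- The partial derivative of a function on `ℂⁿ` in the direction of a frame vector. -/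
def partialDeriv {n : ℕ} (a : Fin n ⊕ Fin n) (f : (Fin n → ℂ) → ℝ) (z : Fin n → ℂ) : ℝ :=
  fderiv ℝ f z (frame a)

/-- The matrix `g_{ab}` of the metric in the real coordinates. -/
def gram (z : Fin n → ℂ) : Matrix (Fin n ⊕ Fin n) (Fin n ⊕ Fin n) ℝ :=
  Matrix.of fun a b => g.inner (z : M n) (frame a) (frame b)

/-- The Christoffel symbols of the Levi-Civita connection:
`Γᵃ_{bc} = ½ ∑_d g^{ad} (∂_b g_{dc} + ∂_c g_{db} - ∂_d g_{bc})`. -/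
def christoffel (a b c : Fin n ⊕ Fin n) (z : Fin n → ℂ) : ℝ :=
  (1 / 2) * ∑ d, (g.gram z)⁻¹ a d *
    (partialDeriv b (fun ζ => g.gram ζ d c) z + partialDeriv c (fun ζ => g.gram ζ d b) z
      - partialDeriv d (fun ζ => g.gram ζ b c) z)

/-- The components of the Riemann tensor, `R(∂_c, ∂_d) ∂_b = ∑_a Rᵃ_{bcd} ∂_a`, where
`R(X, Y) = [∇_X, ∇_Y] - ∇_{[X, Y]}`. -/
def riemann (a b c d : Fin n ⊕ Fin n) (z : Fin n → ℂ) : ℝ :=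
  partialDeriv c (g.christoffel a d b) z - partialDeriv d (g.christoffel a c b) z
    + ∑ e, (g.christoffel a c e z * g.christoffel e d b z
      - g.christoffel a d e z * g.christoffel e c b z)

/-- The Ricci tensor at the point `[z]` of `M`: the bilinear form whose components are
`Ric_{bd} = ∑_a Rᵃ_{bad}`. -/
def ricci (z v w : Fin n → ℂ) : ℝ :=
  ∑ b, ∑ d, (∑ a, g.riemann a b a d z) * component v b * component w d

/-- `Ric ≤ 0`. -/
def RicciNonpos : Prop := ∀ z v, g.ricci z v v ≤ 0

/-- `Ric ≥ 0`. -/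
def RicciNonneg : Prop := ∀ z v, 0 ≤ g.ricci z v v

/-- `Ric = 0`. -/
def RicciFlat : Prop := ∀ z v w, g.ricci z v w = 0

/-- The Riemannian volume of the canonical `n`-torus `{[x + iy] : y ∈ ℝⁿ}`, as a function of `x`:
the integral of the density `√det g(∂y_j, ∂y_k)` of the induced metric over the fundamental domain
`[0, 2π]ⁿ` of the parametrisation `y ↦ [x + iy]`. -/
def torusVolume (x : Fin n → ℝ) : ℝ :=
  ∫ y in Set.Icc (0 : Fin n → ℝ) (fun _ => 2 * Real.pi),
    Real.sqrt (Matrix.det (Matrix.of fun j k : Fin n =>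
      g.inner ((fun l => (x l : ℂ) + (y l : ℂ) * Complex.I : Fin n → ℂ) : M n)
        (frame (Sum.inr j)) (frame (Sum.inr k))))

end RiemannianMetric

end KahlerTorus

end

noncomputable section

section SecondDerivative

variable {E : Type*} [NormedAddCommGroup E] [NormedSpace ℝ E] {f : E → ℝ}

theorem hasDerivAt_comp_line (hf : Differentiable ℝ f) (x v : E) (t : ℝ) :
    HasDerivAt (fun s : ℝ => f (x + s • v)) (fderiv ℝ f (x + t • v) v) t := by
  have h : HasDerivAt (fun s : ℝ => x + s • v) v t := by
    simpa using ((hasDerivAt_id t).smul_const v).const_add x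
  exact (hf (x + t • v)).hasFDerivAt.comp_hasDerivAt t h

theorem differentiable_fderiv_apply (hf : ContDiff ℝ 2 f) (v : E) :
    Differentiable ℝ fun y => fderiv ℝ f y v :=
  ((hf.fderiv_right (m := 1) (by norm_num)).differentiable (by norm_num)).clm_apply
    (differentiable_const v)

theorem convexOn_univ_iff_fderiv_fderiv_nonneg (hf : ContDiff ℝ 2 f) :
    ConvexOn ℝ Set.univ f ↔ ∀ x v, 0 ≤ fderiv ℝ (fun y => fderiv ℝ f y v) x v := by
  have hd : Differentiable ℝ f := hf.differentiable (by norm_num)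
  have h1 : ∀ x v : E, deriv (fun s : ℝ => f (x + s • v)) =
      fun s => fderiv ℝ f (x + s • v) v := fun x v =>
    funext fun t => (hasDerivAt_comp_line hd x v t).deriv
  have h2 : ∀ (x v : E) (t : ℝ), HasDerivAt (fun s : ℝ => fderiv ℝ f (x + s • v) v)
      (fderiv ℝ (fun y => fderiv ℝ f y v) (x + t • v) v) t := fun x v t =>
    hasDerivAt_comp_line (differentiable_fderiv_apply hf v) x v t
  constructor
  · intro h x v
    have hline : ConvexOn ℝ Set.univ (fun s : ℝ => f (x + s • v)) := by
      refine ⟨convex_univ, fun s _ t _ a b ha hb hab => ?_⟩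
      have := h.2 (Set.mem_univ (x + s • v)) (Set.mem_univ (x + t • v)) ha hb hab
      convert this using 2
      rw [smul_add, smul_add, add_add_add_comm, ← add_smul, hab, one_smul, smul_smul, smul_smul,
        ← add_smul, smul_eq_mul, smul_eq_mul]
    have hmono : MonotoneOn (deriv fun s : ℝ => f (x + s • v)) Set.univ :=
      hline.monotoneOn_deriv fun t _ => (hasDerivAt_comp_line hd x v t).differentiableAt
    rw [h1, monotoneOn_univ] at hmono
    have h0 := hmono.deriv_nonneg (x := 0)
    rw [(h2 x v 0).deriv] at h0
    simpa using h0
  · intro h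
    refine ⟨convex_univ, fun x _ y _ a b ha hb hab => ?_⟩
    have hline : ConvexOn ℝ Set.univ (fun s : ℝ => f (x + s • (y - x))) := by
      refine convexOn_univ_of_deriv2_nonneg
        (fun t => (hasDerivAt_comp_line hd x (y - x) t).differentiableAt) ?_ fun t => ?_
      · rw [h1]
        exact fun t => (h2 x (y - x) t).differentiableAt
      · rw [Function.iterate_succ, Function.iterate_one, Function.comp_apply, h1, (h2 _ _ t).deriv]
        exact h _ _
    have := hline.2 (Set.mem_univ 0) (Set.mem_univ 1) ha hb hab
    have hxy : a • x + b • y = x + b • (y - x) := by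
      rw [← eq_sub_iff_add_eq] at hab
      rw [hab, smul_sub, sub_smul, one_smul]
      abel
    rw [hxy]
    simpa using this

theorem concaveOn_univ_iff_fderiv_fderiv_nonpos (hf : ContDiff ℝ 2 f) :
    ConcaveOn ℝ Set.univ f ↔ ∀ x v, fderiv ℝ (fun y => fderiv ℝ f y v) x v ≤ 0 := by
  rw [← neg_convexOn_iff]
  refine (convexOn_univ_iff_fderiv_fderiv_nonneg hf.neg).trans ?_
  refine forall₂_congr fun x v => ?_
  have : (fun y => fderiv ℝ (-f) y v) = fun y => -fderiv ℝ f y v := by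
    funext y
    simp [fderiv_neg]
  change 0 ≤ fderiv ℝ (fun y => fderiv ℝ (-f) y v) x v ↔ _
  rw [this, fderiv_fun_neg]
  simp

theorem exists_linear_add_const_of_fderiv_fderiv_eq_zero (hf : ContDiff ℝ 2 f)
    (h : ∀ x v w, fderiv ℝ (fun y => fderiv ℝ f y v) x w = 0) :
    ∃ (L : E →ₗ[ℝ] ℝ) (c : ℝ), ∀ x, f x = L x + c := by
  refine ⟨(fderiv ℝ f 0 : E →ₗ[ℝ] ℝ), f 0, fun x => ?_⟩
  have hconst : ∀ y, fderiv ℝ f y = fderiv ℝ f 0 := fun y => by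
    ext v
    exact is_const_of_fderiv_eq_zero (differentiable_fderiv_apply hf v)
      (fun z => by ext w; exact h z v w) y 0
  have hd : Differentiable ℝ f := hf.differentiable (by norm_num)
  have := is_const_of_fderiv_eq_zero (𝕜 := ℝ) (f := fun y => f y - fderiv ℝ f 0 y)
    (hd.sub (fderiv ℝ f 0).differentiable)
    (fun y => by
      rw [fderiv_fun_sub (hd y) (fderiv ℝ f 0).differentiableAt, ContinuousLinearMap.fderiv,
        hconst, sub_self]) x 0
  simp only [map_zero, sub_zero] at this
  rw [ContinuousLinearMap.coe_coe]
  linarith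

end SecondDerivative

section MatrixCalculus

open Matrix

variable {E : Type*} [NormedAddCommGroup E] [NormedSpace ℝ E]
  {ι : Type*} [Fintype ι] [DecidableEq ι] {H : E → Matrix ι ι ℝ} {k : WithTop ℕ∞}

theorem ContDiff.matrix_det (hH : ∀ i j, ContDiff ℝ k fun z => H z i j) :
    ContDiff ℝ k fun z => (H z).det := by
  simp only [det_apply']
  exact ContDiff.sum fun σ _ => contDiff_const.mul (contDiff_prod fun i _ => hH _ _)

theorem ContDiff.matrix_inv (hH : ∀ i j, ContDiff ℝ k fun z => H z i j)
    (hdet : ∀ z, (H z).det ≠ 0) (i j : ι) : ContDiff ℝ k fun z => (H z)⁻¹ i j := by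
  simp only [inv_def, Ring.inverse_eq_inv', Matrix.smul_apply, smul_eq_mul, adjugate_apply]
  refine ((ContDiff.matrix_det hH).inv hdet).mul (ContDiff.matrix_det fun a b => ?_)
  rcases eq_or_ne a j with rfl | h
  · simpa only [updateRow_self] using contDiff_const
  · simpa only [updateRow_ne h] using hH a b

theorem det_updateRow_eq_sum_adjugate (A : Matrix ι ι ℝ) (i : ι) (w : ι → ℝ) :
    (A.updateRow i w).det = ∑ j, A.adjugate j i * w j := by
  rw [← cramer_transpose_apply, cramer_eq_adjugate_mulVec, ← adjugate_transpose]
  rfl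

/-- Jacobi's formula. -/
theorem fderiv_matrix_det (hH : ∀ i j, Differentiable ℝ fun z => H z i j) (z v : E) :
    fderiv ℝ (fun z => (H z).det) z v =
      ∑ i, ∑ j, (H z).adjugate j i * fderiv ℝ (fun z => H z i j) z v := by
  let D : ContinuousMultilinearMap ℝ (fun _ : ι => ι → ℝ) ℝ :=
    ⟨(detRowAlternating (n := ι) (R := ℝ)).toMultilinearMap, by
      exact Continuous.matrix_det continuous_id⟩
  have hrow : ∀ i, HasFDerivAt (fun z => H z i)
      (ContinuousLinearMap.pi fun j => fderiv ℝ (fun z => H z i j) z) z := fun i =>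
    hasFDerivAt_pi.2 fun j => (hH i j z).hasFDerivAt
  have h := HasFDerivAt.multilinear_comp (f := D) hrow
  have h' : (fun z => (H z).det) = fun z => D fun i => H z i := rfl
  rw [h', h.fderiv]
  simp only [_root_.sum_apply, ContinuousLinearMap.comp_apply]
  refine Finset.sum_congr rfl fun i _ => ?_
  exact det_updateRow_eq_sum_adjugate (H z) i _

theorem fderiv_log_det (hH : ∀ i j, Differentiable ℝ fun z => H z i j)
    (hdet : ∀ z, (H z).det ≠ 0) (z v : E) :
    fderiv ℝ (fun z => Real.log (H z).det) z v =
      ∑ i, ∑ j, (H z)⁻¹ j i * fderiv ℝ (fun z => H z i j) z v := by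
  have hd : DifferentiableAt ℝ (fun z => (H z).det) z := by
    simp only [det_apply']
    fun_prop
  rw [fderiv.log hd (hdet z), _root_.smul_apply, fderiv_matrix_det hH]
  simp only [inv_def, Ring.inverse_eq_inv', Matrix.smul_apply, smul_eq_mul, Finset.mul_sum, mul_assoc]

theorem fderiv_matrix_inv (hH : ∀ i j, ContDiff ℝ 1 fun z => H z i j)
    (hdet : ∀ z, (H z).det ≠ 0) (i j : ι) (z v : E) :
    fderiv ℝ (fun z => (H z)⁻¹ i j) z v =
      -∑ p, ∑ q, (H z)⁻¹ i p * fderiv ℝ (fun z => H z p q) z v * (H z)⁻¹ q j := by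
  have hHd : ∀ i j, Differentiable ℝ fun z => H z i j := fun i j =>
    (hH i j).differentiable one_ne_zero
  have hKd : ∀ i j, Differentiable ℝ fun z => (H z)⁻¹ i j := fun i j =>
    (ContDiff.matrix_inv hH hdet i j).differentiable one_ne_zero
  have hunit : IsUnit (H z).det := (hdet z).isUnit
  set dK : Matrix ι ι ℝ := of fun i j => fderiv ℝ (fun z => (H z)⁻¹ i j) z v with hdK
  set dH : Matrix ι ι ℝ := of fun i j => fderiv ℝ (fun z => H z i j) z v with hdH
  have key : dK * H z + (H z)⁻¹ * dH = 0 := by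
    ext a b
    have hc : (fun z => ∑ p, (H z)⁻¹ a p * H z p b) = fun _ => (1 : Matrix ι ι ℝ) a b := by
      funext y
      rw [← nonsing_inv_mul (H y) (hdet y).isUnit, mul_apply]
    have h0 := congrArg (fun F => fderiv ℝ F z v) hc
    simp only [fderiv_fun_const] at h0
    rw [fderiv_fun_sum fun p _ => (hKd a p z).fun_mul (hHd p b z)] at h0
    simp only [fderiv_fun_mul (hKd _ _ z) (hHd _ _ z), _root_.sum_apply,
      _root_.add_apply, _root_.smul_apply, smul_eq_mul] at h0
    rw [Matrix.add_apply, mul_apply, mul_apply, ← Finset.sum_add_distrib, Matrix.zero_apply]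
    rw [Pi.zero_apply, _root_.zero_apply] at h0
    rw [← h0]
    refine Finset.sum_congr rfl fun p _ => ?_
    simp only [hdK, hdH, of_apply]
    ring
  have h1 : dK = -((H z)⁻¹ * dH * (H z)⁻¹) := by
    rw [← mul_nonsing_inv_cancel_right (H z) dK hunit, eq_neg_of_add_eq_zero_left key,
      Matrix.neg_mul]
  have h2 := congrFun (congrFun h1 i) j
  simp only [hdK, hdH, of_apply, Matrix.neg_apply, mul_apply, Finset.sum_mul] at h2
  rw [h2, Finset.sum_comm]

end MatrixCalculus

namespace KahlerTorus

namespace RiemannianMetric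

open Matrix

section PartialDerivatives

variable {n : ℕ} {f : (Fin n → ℂ) → ℝ}

theorem contDiff_partialDeriv (hf : ContDiff ℝ ∞ f) (a : Fin n ⊕ Fin n) :
    ContDiff ℝ ∞ (partialDeriv a f) :=
  (hf.fderiv_right (m := ∞) (by simp)).clm_apply contDiff_const

theorem partialDeriv_comm (hf : ContDiff ℝ ∞ f) (a b : Fin n ⊕ Fin n) :
    partialDeriv a (partialDeriv b f) = partialDeriv b (partialDeriv a f) := by
  have hd : Differentiable ℝ f := hf.differentiable (by simp)
  have hd' : Differentiable ℝ (fderiv ℝ f) :=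
    (hf.fderiv_right (m := ∞) (by simp)).differentiable (by simp)
  have h1 : ∀ (a b : Fin n ⊕ Fin n) z, partialDeriv a (partialDeriv b f) z =
      fderiv ℝ (fderiv ℝ f) z (frame a) (frame b) := fun a b z => by
    change fderiv ℝ (fun y => fderiv ℝ f y (frame b)) z (frame a) = _
    rw [fderiv_clm_apply (hd' z) (differentiableAt_const _)]
    simp
  funext z
  rw [h1, h1]
  exact second_derivative_symmetric (fun y => (hd y).hasFDerivAt) (hd' z).hasFDerivAt _ _

@[simp]
theorem partialDeriv_const (a : Fin n ⊕ Fin n) (c : ℝ) (z : Fin n → ℂ) :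
    partialDeriv a (fun _ => c) z = 0 := by
  simp [partialDeriv]

@[simp]
theorem partialDeriv_zero (a : Fin n ⊕ Fin n) (z : Fin n → ℂ) :
    partialDeriv a 0 z = 0 :=
  partialDeriv_const a 0 z

@[simp]
theorem partialDeriv_neg (a : Fin n ⊕ Fin n) (z : Fin n → ℂ) :
    partialDeriv a (-f) z = -partialDeriv a f z := by
  simp [partialDeriv, fderiv_neg]

theorem partialDeriv_const_mul_sum_mul {ι : Type*} [Fintype ι] {F G : ι → (Fin n → ℂ) → ℝ}
    (hF : ∀ i, Differentiable ℝ (F i)) (hG : ∀ i, Differentiable ℝ (G i)) (c : ℝ)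
    (a : Fin n ⊕ Fin n) (z : Fin n → ℂ) :
    partialDeriv a (fun ζ => c * ∑ i, F i ζ * G i ζ) z =
      c * ∑ i, (partialDeriv a (F i) z * G i z + F i z * partialDeriv a (G i) z) := by
  have hFG : ∀ i, DifferentiableAt ℝ (fun ζ => F i ζ * G i ζ) z := fun i => (hF i z).mul (hG i z)
  unfold partialDeriv
  rw [fderiv_const_mul (DifferentiableAt.fun_sum fun i _ => hFG i),
    fderiv_fun_sum fun i _ => hFG i]
  simp only [fderiv_fun_mul (hF _ z) (hG _ z), _root_.sum_apply, _root_.add_apply,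
    _root_.smul_apply, smul_eq_mul]
  congr 1
  exact Finset.sum_congr rfl fun i _ => by ring

end PartialDerivatives

section HamiltonianMetric

variable {n : ℕ} (g : RiemannianMetric n)

/-- The matrix `g(∂x_j, ∂x_k)`. -/
def baseGram (z : Fin n → ℂ) : Matrix (Fin n) (Fin n) ℝ :=
  of fun j k => g.inner (z : M n) (frame (Sum.inl j)) (frame (Sum.inl k))

theorem contDiff_inner (v w : Fin n → ℂ) :
    ContDiff ℝ ∞ fun z : Fin n → ℂ => g.inner (z : M n) v w :=
  (g.smooth.clm_apply contDiff_const).clm_apply contDiff_const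

theorem contDiff_baseGram (j k : Fin n) : ContDiff ℝ ∞ fun z => g.baseGram z j k :=
  g.contDiff_inner _ _

theorem baseGram_symm (z : Fin n → ℂ) (j k : Fin n) : g.baseGram z j k = g.baseGram z k j :=
  g.symm _ _ _

theorem posDef_baseGram (z : Fin n → ℂ) : (g.baseGram z).PosDef := by
  refine PosDef.of_dotProduct_mulVec_pos (by ext j k; exact g.symm _ _ _) fun u hu => ?_
  have hsum : (∑ j, u j • (frame (Sum.inl j) : Fin n → ℂ)) ≠ 0 := by
    contrapose! hu
    ext j
    have := congrFun hu j
    simpa [frame, Finset.sum_apply, Pi.single_apply] using this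
  have h := g.pos (z : M n) _ hsum
  simp only [map_sum, map_smul, _root_.sum_apply, _root_.smul_apply, smul_eq_mul] at h
  simp only [dotProduct, mulVec, baseGram, of_apply, star_trivial]
  refine h.trans_eq (Finset.sum_congr rfl fun j _ => congrArg _ (Finset.sum_congr rfl fun k _ => ?_))
  rw [g.symm, mul_comm]

theorem det_baseGram_pos (z : Fin n → ℂ) : 0 < (g.baseGram z).det :=
  (g.posDef_baseGram z).det_pos

theorem fundamentalField_single (j : Fin n) :
    fundamentalField (Pi.single j (1 : ℝ)) = frame (Sum.inr j) := by
  ext k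
  rcases eq_or_ne k j with rfl | h
  · simp [fundamentalField, imaginary, frame]
  · simp [fundamentalField, imaginary, frame, h]

theorem I_smul_frame_inl (j : Fin n) :
    Complex.I • (frame (Sum.inl j) : Fin n → ℂ) = frame (Sum.inr j) := by
  simp [frame, ← Pi.single_smul]

theorem I_smul_frame_inr (j : Fin n) :
    Complex.I • (frame (Sum.inr j) : Fin n → ℂ) = -frame (Sum.inl j) := by
  simp [frame, ← Pi.single_smul, ← Pi.single_neg]

variable {g} {μ : M n → (Fin n → ℝ) →ₗ[ℝ] ℝ}

theorem IsMomentMap.hasFDerivAt (hμ : g.IsMomentMap μ) (j : Fin n) (z : Fin n → ℂ) :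
    HasFDerivAt (fun ζ : Fin n → ℂ => -μ (ζ : M n) (Pi.single j 1))
      (g.inner (z : M n) (frame (Sum.inl j))) z := by
  have := (hμ.deriv (Pi.single j 1) z).neg
  rw [fundamentalField_single, omega, I_smul_frame_inr, map_neg, neg_neg] at this
  exact this

theorem IsMomentMap.inner_frame_inl_inr (hμ : g.IsMomentMap μ) (j k : Fin n) (z : Fin n → ℂ) :
    g.inner (z : M n) (frame (Sum.inl j)) (frame (Sum.inr k)) = 0 := by
  have hconst : (fun s : ℝ => -μ ((z + s • frame (Sum.inr k) : Fin n → ℂ) : M n) (Pi.single j 1))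
      = fun _ => -μ (z : M n) (Pi.single j 1) := by
    funext s
    rw [← fundamentalField_single, ← rotate_coe, hμ.equivariant]
  have h := hasDerivAt_comp_line (fun y => (hμ.hasFDerivAt j y).differentiableAt) z
    (frame (Sum.inr k)) 0
  rw [hconst, zero_smul, add_zero, (hμ.hasFDerivAt j z).fderiv] at h
  exact h.unique (hasDerivAt_const _ _)

theorem IsMomentMap.fderiv_inner_symm (hμ : g.IsMomentMap μ) (j : Fin n) (z v w : Fin n → ℂ) :
    fderiv ℝ (fun ζ : Fin n → ℂ => g.inner (ζ : M n) (frame (Sum.inl j)) v) z w =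
      fderiv ℝ (fun ζ : Fin n → ℂ => g.inner (ζ : M n) (frame (Sum.inl j)) w) z v := by
  have hd : DifferentiableAt ℝ (fun ζ : Fin n → ℂ => g.inner (ζ : M n) (frame (Sum.inl j))) z :=
    (g.smooth.clm_apply contDiff_const).differentiable (by simp) z
  have h1 : ∀ v w, fderiv ℝ (fun ζ : Fin n → ℂ => g.inner (ζ : M n) (frame (Sum.inl j)) v) z w =
      fderiv ℝ (fun ζ : Fin n → ℂ => g.inner (ζ : M n) (frame (Sum.inl j))) z w v := fun v w => by
    rw [fderiv_clm_apply hd (differentiableAt_const _)]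
    simp
  rw [h1, h1]
  exact second_derivative_symmetric (hμ.hasFDerivAt j) hd.hasFDerivAt _ _

theorem gram_eq_fromBlocks (hK : g.IsKahler) (hH : g.IsHamiltonian) :
    g.gram = fun z => fromBlocks (g.baseGram z) 0 0 (g.baseGram z) := by
  obtain ⟨μ, hμ⟩ := hH
  funext z
  ext (j | j) (k | k)
  · rfl
  · exact hμ.inner_frame_inl_inr j k z
  · exact (g.symm _ _ _).trans (hμ.inner_frame_inl_inr k j z)
  · rw [fromBlocks_apply₂₂, gram, of_apply, ← I_smul_frame_inl, ← I_smul_frame_inl, hK.hermitian]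
    rfl

theorem partialDeriv_inr_baseGram (hH : g.IsHamiltonian) (j k l : Fin n) :
    partialDeriv (Sum.inr l) (fun z => g.baseGram z j k) = 0 := by
  obtain ⟨μ, hμ⟩ := hH
  funext z
  refine (hμ.fderiv_inner_symm j z (frame (Sum.inl k)) (frame (Sum.inr l))).trans ?_
  simp only [hμ.inner_frame_inl_inr]
  exact partialDeriv_const (Sum.inl k) 0 z

variable (g) in
/-- The derivatives `∂g(∂x_j, ∂x_k)/∂x_l`. -/
def dGram (j k l : Fin n) : (Fin n → ℂ) → ℝ :=
  partialDeriv (Sum.inl l) fun z => g.baseGram z j k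

theorem dGram_swap_left (j k l : Fin n) : g.dGram j k l = g.dGram k j l := by
  unfold dGram
  simp only [g.baseGram_symm _ j k]

theorem dGram_swap_right (hH : g.IsHamiltonian) (j k l : Fin n) :
    g.dGram j k l = g.dGram j l k := by
  obtain ⟨μ, hμ⟩ := hH
  funext z
  exact hμ.fderiv_inner_symm j z (frame (Sum.inl k)) (frame (Sum.inl l))

theorem contDiff_dGram (j k l : Fin n) : ContDiff ℝ ∞ (g.dGram j k l) :=
  contDiff_partialDeriv (g.contDiff_baseGram j k) _

theorem partialDeriv_inr_dGram (hH : g.IsHamiltonian) (j k l m : Fin n) :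
    partialDeriv (Sum.inr m) (g.dGram j k l) = 0 := by
  unfold dGram
  rw [partialDeriv_comm (g.contDiff_baseGram j k), partialDeriv_inr_baseGram hH]
  funext z
  exact partialDeriv_zero _ z

theorem partialDeriv_dGram_swap (j k l m : Fin n) :
    partialDeriv (Sum.inl m) (g.dGram j k l) = partialDeriv (Sum.inl l) (g.dGram j k m) :=
  partialDeriv_comm (g.contDiff_baseGram j k) _ _

theorem contDiff_baseGram_inv (j k : Fin n) : ContDiff ℝ ∞ fun z => (g.baseGram z)⁻¹ j k :=
  ContDiff.matrix_inv g.contDiff_baseGram (fun z => (g.det_baseGram_pos z).ne') j k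

theorem partialDeriv_baseGram_inv (a : Fin n ⊕ Fin n) (j k : Fin n) (z : Fin n → ℂ) :
    partialDeriv a (fun ζ => (g.baseGram ζ)⁻¹ j k) z =
      -∑ p, ∑ q, (g.baseGram z)⁻¹ j p * partialDeriv a (fun ζ => g.baseGram ζ p q) z *
        (g.baseGram z)⁻¹ q k :=
  fderiv_matrix_inv (fun j k => (g.contDiff_baseGram j k).of_le (by simp))
    (fun z => (g.det_baseGram_pos z).ne') j k z _

variable (g) in
/-- The Christoffel symbols of the metric `g(∂x_j, ∂x_k)` on the base `ℝⁿ`. -/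
def baseChristoffel (a b c : Fin n) (z : Fin n → ℂ) : ℝ :=
  (1 / 2) * ∑ d, (g.baseGram z)⁻¹ a d * g.dGram d b c z

theorem baseChristoffel_swap (hH : g.IsHamiltonian) (a b c : Fin n) :
    g.baseChristoffel a b c = g.baseChristoffel a c b := by
  funext z
  simp only [baseChristoffel, dGram_swap_right hH _ b c]

theorem partialDeriv_baseChristoffel (a : Fin n ⊕ Fin n) (i j k : Fin n) (z : Fin n → ℂ) :
    partialDeriv a (g.baseChristoffel i j k) z = (1 / 2) * ∑ d,
      (partialDeriv a (fun ζ => (g.baseGram ζ)⁻¹ i d) z * g.dGram d j k z +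
        (g.baseGram z)⁻¹ i d * partialDeriv a (g.dGram d j k) z) :=
  partialDeriv_const_mul_sum_mul (fun d => (contDiff_baseGram_inv i d).differentiable (by simp))
    (fun d => (contDiff_dGram d j k).differentiable (by simp)) _ a z

@[simp]
theorem partialDeriv_inr_baseChristoffel (hH : g.IsHamiltonian) (l a b c : Fin n)
    (z : Fin n → ℂ) : partialDeriv (Sum.inr l) (g.baseChristoffel a b c) z = 0 := by
  simp [partialDeriv_baseChristoffel, partialDeriv_baseGram_inv, partialDeriv_inr_baseGram hH,
    partialDeriv_inr_dGram hH]

theorem partialDeriv_inl_baseChristoffel (l a b c : Fin n)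
    (z : Fin n → ℂ) :
    partialDeriv (Sum.inl l) (g.baseChristoffel a b c) z =
      (1 / 2) * ∑ d, (g.baseGram z)⁻¹ a d * partialDeriv (Sum.inl l) (g.dGram d b c) z
        - 2 * ∑ q, g.baseChristoffel a q l z * g.baseChristoffel q b c z := by
  have h1 : ∀ d, partialDeriv (Sum.inl l) (fun ζ => (g.baseGram ζ)⁻¹ a d) z =
      -∑ q, 2 * g.baseChristoffel a q l z * (g.baseGram z)⁻¹ q d := fun d => by
    rw [partialDeriv_baseGram_inv, Finset.sum_comm]
    simp only [baseChristoffel, ← Finset.sum_mul]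
    congr 1
    refine Finset.sum_congr rfl fun q _ => ?_
    rw [← mul_assoc, show (2 : ℝ) * (1 / 2) = 1 by norm_num, one_mul]
    rfl
  have h2 : ∑ d, (∑ q, 2 * g.baseChristoffel a q l z * (g.baseGram z)⁻¹ q d) * g.dGram d b c z =
      4 * ∑ q, g.baseChristoffel a q l z * g.baseChristoffel q b c z := by
    simp only [Finset.sum_mul, Finset.mul_sum]
    rw [Finset.sum_comm]
    refine Finset.sum_congr rfl fun q _ => ?_
    rw [baseChristoffel.eq_def g q b c z, Finset.mul_sum, Finset.mul_sum, Finset.mul_sum]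
    exact Finset.sum_congr rfl fun d _ => by ring
  rw [partialDeriv_baseChristoffel]
  simp only [h1, neg_mul, Finset.sum_add_distrib, Finset.sum_neg_distrib, h2]
  ring

/-- The contracted form of the identity `∂_l Γᵃ_{bc} + 2 Γᵃ_{lq} Γ^q_{bc} = ½ g^{ad} ∂_l ∂_c g_{db}`,
whose right-hand side is symmetric in the lower indices. -/
theorem sum_partialDeriv_baseChristoffel (hH : g.IsHamiltonian) (b d : Fin n) (z : Fin n → ℂ) :
    ∑ a, partialDeriv (Sum.inl a) (g.baseChristoffel a d b) z =
      ∑ a, partialDeriv (Sum.inl d) (g.baseChristoffel a a b) z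
        + 2 * ∑ a, ∑ q, g.baseChristoffel a d q z * g.baseChristoffel q a b z
        - 2 * ∑ a, ∑ q, g.baseChristoffel a a q z * g.baseChristoffel q d b z := by
  have hS : ∀ a f, partialDeriv (Sum.inl a) (g.dGram f d b) =
      partialDeriv (Sum.inl d) (g.dGram f a b) := fun a f => by
    rw [dGram_swap_right hH f d b, partialDeriv_dGram_swap, dGram_swap_right hH f b a]
  simp only [partialDeriv_inl_baseChristoffel, Finset.sum_sub_distrib, ← Finset.mul_sum, hS]
  have h1 : ∀ a q, g.baseChristoffel a q a z = g.baseChristoffel a a q z := fun a q => by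
    rw [baseChristoffel_swap hH]
  have h2 : ∀ a q, g.baseChristoffel a q d z = g.baseChristoffel a d q z := fun a q => by
    rw [baseChristoffel_swap hH]
  simp only [h1, h2]
  ring

end HamiltonianMetric

section RicciTensor

variable {n : ℕ} {g : RiemannianMetric n}

theorem fromBlocks_diagonal_inv (A : Matrix (Fin n) (Fin n) ℝ) :
    (fromBlocks A 0 0 A)⁻¹ = fromBlocks A⁻¹ 0 0 A⁻¹ := by
  rw [inv_fromBlocks_zero₂₁_of_isUnit_iff _ _ _ Iff.rfl]
  simp

theorem christoffel_inl_inl_inl (hK : g.IsKahler) (hH : g.IsHamiltonian) (a b c : Fin n) :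
    g.christoffel (Sum.inl a) (Sum.inl b) (Sum.inl c) = g.baseChristoffel a b c := by
  funext z
  simp only [christoffel, fromBlocks_diagonal_inv, gram_eq_fromBlocks hK hH, Fintype.sum_sum_type,
    fromBlocks_apply₁₁, fromBlocks_apply₁₂, fromBlocks_apply₂₁, Matrix.zero_apply, zero_mul,
    Finset.sum_const_zero, add_zero, baseChristoffel]
  refine congrArg _ (Finset.sum_congr rfl fun d _ => congrArg _ ?_)
  change g.dGram d c b z + g.dGram d b c z - g.dGram b c d z = _
  rw [dGram_swap_right hH d c b, dGram_swap_left d b c, dGram_swap_right hH b d c]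
  ring

theorem christoffel_inl_inr_inr (hK : g.IsKahler) (hH : g.IsHamiltonian) (a b c : Fin n) :
    g.christoffel (Sum.inl a) (Sum.inr b) (Sum.inr c) = -g.baseChristoffel a b c := by
  funext z
  simp only [christoffel, fromBlocks_diagonal_inv, gram_eq_fromBlocks hK hH, Fintype.sum_sum_type,
    fromBlocks_apply₁₁, fromBlocks_apply₁₂, fromBlocks_apply₂₂,
    Matrix.zero_apply, zero_mul,
    Finset.sum_const_zero, add_zero, baseChristoffel, partialDeriv_const, zero_sub, Pi.neg_apply]
  rw [← mul_neg, ← Finset.sum_neg_distrib]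
  refine congrArg _ (Finset.sum_congr rfl fun d _ => ?_)
  rw [mul_neg, dGram_swap_left d b c, dGram_swap_right hH b d c]
  rfl

theorem christoffel_inr_inl_inr (hK : g.IsKahler) (hH : g.IsHamiltonian) (a b c : Fin n) :
    g.christoffel (Sum.inr a) (Sum.inl b) (Sum.inr c) = g.baseChristoffel a b c := by
  funext z
  simp only [christoffel, fromBlocks_diagonal_inv, gram_eq_fromBlocks hK hH, Fintype.sum_sum_type,
    fromBlocks_apply₁₁, fromBlocks_apply₁₂, fromBlocks_apply₂₁, fromBlocks_apply₂₂,
    Matrix.zero_apply, zero_mul,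
    Finset.sum_const_zero, add_zero, zero_add, baseChristoffel, partialDeriv_const, sub_zero]
  refine congrArg _ (Finset.sum_congr rfl fun d _ => congrArg _ ?_)
  rw [dGram_swap_right hH d b c]
  rfl

theorem christoffel_swap (a b c : Fin n ⊕ Fin n) :
    g.christoffel a b c = g.christoffel a c b := by
  have h : ∀ z, g.gram z b c = g.gram z c b := fun z => g.symm _ _ _
  funext z
  simp only [christoffel, h]
  refine congrArg _ (Finset.sum_congr rfl fun d _ => ?_)
  ring

theorem christoffel_inr_inr_inl (hK : g.IsKahler) (hH : g.IsHamiltonian) (a b c : Fin n) :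
    g.christoffel (Sum.inr a) (Sum.inr b) (Sum.inl c) = g.baseChristoffel a b c := by
  rw [christoffel_swap, christoffel_inr_inl_inr hK hH, baseChristoffel_swap hH]

theorem christoffel_inl_inl_inr (hK : g.IsKahler) (hH : g.IsHamiltonian) (a b c : Fin n) :
    g.christoffel (Sum.inl a) (Sum.inl b) (Sum.inr c) = 0 := by
  funext z
  have := fun d => congrFun (partialDeriv_inr_baseGram hH d b c) z
  simp only [christoffel, fromBlocks_diagonal_inv, gram_eq_fromBlocks hK hH, Fintype.sum_sum_type,
    fromBlocks_apply₁₁, fromBlocks_apply₁₂, fromBlocks_apply₂₁, fromBlocks_apply₂₂,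
    Matrix.zero_apply, zero_mul,
    Finset.sum_const_zero, add_zero, partialDeriv_const, sub_zero, this, Pi.zero_apply, mul_zero]

theorem christoffel_inl_inr_inl (hK : g.IsKahler) (hH : g.IsHamiltonian) (a b c : Fin n) :
    g.christoffel (Sum.inl a) (Sum.inr b) (Sum.inl c) = 0 := by
  rw [christoffel_swap, christoffel_inl_inl_inr hK hH]

theorem christoffel_inr_inl_inl (hK : g.IsKahler) (hH : g.IsHamiltonian) (a b c : Fin n) :
    g.christoffel (Sum.inr a) (Sum.inl b) (Sum.inl c) = 0 := by
  funext z
  have := fun d => congrFun (partialDeriv_inr_baseGram hH b c d) z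
  simp only [christoffel, fromBlocks_diagonal_inv, gram_eq_fromBlocks hK hH, Fintype.sum_sum_type,
    fromBlocks_apply₁₁, fromBlocks_apply₂₁, fromBlocks_apply₂₂,
    Matrix.zero_apply, zero_mul,
    Finset.sum_const_zero, add_zero, partialDeriv_const, sub_zero, this, Pi.zero_apply, mul_zero]

theorem christoffel_inr_inr_inr (hK : g.IsKahler) (hH : g.IsHamiltonian) (a b c : Fin n) :
    g.christoffel (Sum.inr a) (Sum.inr b) (Sum.inr c) = 0 := by
  funext z
  have := fun i j k => congrFun (partialDeriv_inr_baseGram hH i j k) z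
  simp only [christoffel, fromBlocks_diagonal_inv, gram_eq_fromBlocks hK hH, Fintype.sum_sum_type,
    fromBlocks_apply₁₂, fromBlocks_apply₂₁, fromBlocks_apply₂₂,
    Matrix.zero_apply, zero_mul,
    Finset.sum_const_zero, add_zero, sub_zero, this, Pi.zero_apply, mul_zero]

variable (g) in
/-- The logarithm of the determinant of the matrix `g(∂x_j, ∂x_k)`. -/
def logDet (z : Fin n → ℂ) : ℝ := Real.log (g.baseGram z).det

theorem contDiff_logDet : ContDiff ℝ ∞ g.logDet :=
  (ContDiff.matrix_det g.contDiff_baseGram).log fun z => (g.det_baseGram_pos z).ne'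

theorem partialDeriv_logDet (a : Fin n ⊕ Fin n) (z : Fin n → ℂ) :
    partialDeriv a g.logDet z =
      ∑ i, ∑ j, (g.baseGram z)⁻¹ j i * partialDeriv a (fun ζ => g.baseGram ζ i j) z :=
  fderiv_log_det (fun j k => (g.contDiff_baseGram j k).differentiable (by simp))
    (fun z => (g.det_baseGram_pos z).ne') z _

theorem partialDeriv_inr_logDet (hH : g.IsHamiltonian) (a : Fin n) :
    partialDeriv (Sum.inr a) g.logDet = 0 := by
  funext z
  simp [partialDeriv_logDet, partialDeriv_inr_baseGram hH]

theorem partialDeriv_inl_logDet (b : Fin n) :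
    partialDeriv (Sum.inl b) g.logDet = fun z => 2 * ∑ a, g.baseChristoffel a a b z := by
  funext z
  rw [partialDeriv_logDet, Finset.sum_comm, Finset.mul_sum]
  refine Finset.sum_congr rfl fun j _ => ?_
  rw [baseChristoffel, ← mul_assoc, show (2 : ℝ) * (1 / 2) = 1 by norm_num, one_mul]
  rfl

theorem contDiff_baseChristoffel (a b c : Fin n) : ContDiff ℝ ∞ (g.baseChristoffel a b c) :=
  contDiff_const.mul (ContDiff.sum fun d _ =>
    (contDiff_baseGram_inv a d).mul (contDiff_dGram d b c))

theorem partialDeriv_inl_inl_logDet (b d : Fin n) (z : Fin n → ℂ) :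
    partialDeriv (Sum.inl d) (partialDeriv (Sum.inl b) g.logDet) z =
      2 * ∑ a, partialDeriv (Sum.inl d) (g.baseChristoffel a a b) z := by
  have := partialDeriv_const_mul_sum_mul (F := fun a => g.baseChristoffel a a b)
    (G := fun _ _ => 1) (fun a => (contDiff_baseChristoffel a a b).differentiable (by simp))
    (fun _ => differentiable_const _) 2 (Sum.inl d) z
  rw [partialDeriv_inl_logDet]
  simpa using this

theorem ricci_inl_inl (hK : g.IsKahler) (hH : g.IsHamiltonian) (b d : Fin n) (z : Fin n → ℂ) :
    ∑ a, g.riemann a (Sum.inl b) a (Sum.inl d) z =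
      -(1 / 2) * partialDeriv (Sum.inl d) (partialDeriv (Sum.inl b) g.logDet) z := by
  have h := sum_partialDeriv_baseChristoffel hH b d z
  simp only [riemann, Fintype.sum_sum_type, christoffel_inl_inl_inl hK hH,
    christoffel_inr_inl_inr hK hH, christoffel_inr_inr_inl hK hH,
    christoffel_inl_inl_inr hK hH, christoffel_inl_inr_inl hK hH, christoffel_inr_inl_inl hK hH,
    Pi.zero_apply, partialDeriv_zero, mul_zero,
    Finset.sum_const_zero, add_zero, zero_add, Finset.sum_add_distrib,
    Finset.sum_sub_distrib, h, partialDeriv_inl_inl_logDet]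
  ring

theorem ricci_inr_inr (hK : g.IsKahler) (hH : g.IsHamiltonian) (b d : Fin n) (z : Fin n → ℂ) :
    ∑ a, g.riemann a (Sum.inr b) a (Sum.inr d) z =
      -(1 / 2) * partialDeriv (Sum.inl d) (partialDeriv (Sum.inl b) g.logDet) z := by
  have h := sum_partialDeriv_baseChristoffel hH b d z
  simp only [riemann, Fintype.sum_sum_type, christoffel_inl_inl_inl hK hH,
    christoffel_inr_inl_inr hK hH, christoffel_inr_inr_inl hK hH, christoffel_inl_inr_inr hK hH,
    christoffel_inl_inl_inr hK hH, christoffel_inl_inr_inl hK hH,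
    christoffel_inr_inr_inr hK hH, Pi.zero_apply, Pi.neg_apply, partialDeriv_zero,
    partialDeriv_neg, mul_zero, sub_zero, neg_mul,
    mul_neg, Finset.sum_const_zero, add_zero, zero_add, Finset.sum_add_distrib,
    Finset.sum_sub_distrib, Finset.sum_neg_distrib, h, partialDeriv_inl_inl_logDet]
  ring

theorem ricci_inl_inr (hK : g.IsKahler) (hH : g.IsHamiltonian) (b d : Fin n) (z : Fin n → ℂ) :
    ∑ a, g.riemann a (Sum.inl b) a (Sum.inr d) z = 0 := by
  simp [riemann, christoffel_inl_inl_inl hK hH,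
    christoffel_inr_inr_inl hK hH, christoffel_inl_inr_inr hK hH,
    christoffel_inl_inl_inr hK hH, christoffel_inl_inr_inl hK hH, christoffel_inr_inl_inl hK hH,
    christoffel_inr_inr_inr hK hH, partialDeriv_inr_baseChristoffel hH]

theorem ricci_inr_inl (hK : g.IsKahler) (hH : g.IsHamiltonian) (b d : Fin n) (z : Fin n → ℂ) :
    ∑ a, g.riemann a (Sum.inr b) a (Sum.inl d) z = 0 := by
  simp [riemann, christoffel_inl_inl_inl hK hH,
    christoffel_inr_inl_inr hK hH, christoffel_inl_inr_inr hK hH,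
    christoffel_inl_inl_inr hK hH, christoffel_inr_inl_inl hK hH,
    christoffel_inr_inr_inr hK hH, partialDeriv_inr_baseChristoffel hH]

theorem ricci_eq_logDet (hK : g.IsKahler) (hH : g.IsHamiltonian) (z v w : Fin n → ℂ) :
    g.ricci z v w = -(1 / 2) * (
      ∑ b, ∑ d, partialDeriv (Sum.inl d) (partialDeriv (Sum.inl b) g.logDet) z *
        (v b).re * (w d).re +
      ∑ b, ∑ d, partialDeriv (Sum.inl d) (partialDeriv (Sum.inl b) g.logDet) z *
        (v b).im * (w d).im) := by
  let R : Fin n ⊕ Fin n → Fin n ⊕ Fin n → ℝ := fun b d => ∑ a, g.riemann a b a d z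
  have h : ∀ b d, R (Sum.inl b) (Sum.inl d) = _ := fun b d => ricci_inl_inl hK hH b d z
  have h' : ∀ b d, R (Sum.inr b) (Sum.inr d) = _ := fun b d => ricci_inr_inr hK hH b d z
  have h0 : ∀ b d, R (Sum.inl b) (Sum.inr d) = 0 := fun b d => ricci_inl_inr hK hH b d z
  have h0' : ∀ b d, R (Sum.inr b) (Sum.inl d) = 0 := fun b d => ricci_inr_inl hK hH b d z
  change ∑ b, ∑ d, R b d * component v b * component w d = _
  clear_value R
  simp only [Fintype.sum_sum_type, h, h', h0, h0', component, zero_mul, Finset.sum_const_zero,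
    add_zero, zero_add, mul_add, Finset.mul_sum, mul_assoc]

end RicciTensor

section TorusVolume

variable {n : ℕ}

/-- The inclusion `x ↦ x + i0` of `ℝⁿ` in `ℂⁿ`. -/
def ofRealPi (n : ℕ) : (Fin n → ℝ) →L[ℝ] (Fin n → ℂ) :=
  ContinuousLinearMap.pi fun j => Complex.ofRealCLM.comp (ContinuousLinearMap.proj j)

/-- The projection `x + iy ↦ x` from `ℂⁿ` to `ℝⁿ`. -/
def rePi (n : ℕ) : (Fin n → ℂ) →L[ℝ] (Fin n → ℝ) :=
  ContinuousLinearMap.pi fun j => Complex.reCLM.comp (ContinuousLinearMap.proj j)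

@[simp]
theorem ofRealPi_apply (x : Fin n → ℝ) (j : Fin n) : ofRealPi n x j = x j := rfl

@[simp]
theorem rePi_apply (z : Fin n → ℂ) (j : Fin n) : rePi n z j = (z j).re := rfl

theorem rePi_frame_inl (b : Fin n) : rePi n (frame (Sum.inl b)) = Pi.single b 1 := by
  ext j
  rcases eq_or_ne j b with rfl | h
  · simp [frame]
  · simp [frame, h]

theorem sub_ofRealPi_rePi (z : Fin n → ℂ) :
    z - ofRealPi n (rePi n z) = ∑ j, (z j).im • frame (Sum.inr j) := by
  ext j
  simp only [Pi.sub_apply, ofRealPi_apply, rePi_apply, Finset.sum_apply, Pi.smul_apply, frame,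
    Pi.single_apply, smul_ite, smul_zero, Finset.sum_ite_eq, Finset.mem_univ, if_true,
    Complex.real_smul]
  nth_rw 1 [← Complex.re_add_im (z j)]
  ring

theorem eq_comp_rePi {f : (Fin n → ℂ) → ℝ} (hf : Differentiable ℝ f)
    (h : ∀ a, partialDeriv (Sum.inr a) f = 0) (z : Fin n → ℂ) :
    f z = f (ofRealPi n (rePi n z)) := by
  set w := ofRealPi n (rePi n z) with hw
  have hline : ∀ t, HasDerivAt (fun s : ℝ => f (w + s • (z - w))) 0 t := fun t => by
    have := hasDerivAt_comp_line hf w (z - w) t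
    convert this using 1
    rw [hw, sub_ofRealPi_rePi, map_sum]
    refine (Finset.sum_eq_zero fun j _ => ?_).symm
    rw [map_smul]
    exact (congrArg _ (congrFun (h j) _)).trans (smul_zero _)
  have := is_const_of_deriv_eq_zero (fun t => (hline t).differentiableAt)
    (fun t => (hline t).deriv) 1 0
  simpa using this

variable (g : RiemannianMetric n)

/-- The function `log det g(∂x_j, ∂x_k)` on the base `ℝⁿ`. -/
def baseLogDet (x : Fin n → ℝ) : ℝ := g.logDet (ofRealPi n x)

theorem contDiff_baseLogDet : ContDiff ℝ 2 g.baseLogDet :=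
  (contDiff_logDet.comp (ofRealPi n).contDiff).of_le (WithTop.coe_le_coe.2 le_top)

variable {g}

theorem logDet_eq_baseLogDet (hH : g.IsHamiltonian) :
    g.logDet = fun z => g.baseLogDet (rePi n z) :=
  funext (eq_comp_rePi (contDiff_logDet.differentiable (by simp)) (partialDeriv_inr_logDet hH))

theorem partialDeriv_inl_comp_rePi {f : (Fin n → ℝ) → ℝ} (hf : Differentiable ℝ f) (b : Fin n) :
    partialDeriv (Sum.inl b) (fun z => f (rePi n z)) =
      fun z => fderiv ℝ f (rePi n z) (Pi.single b 1) := by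
  funext z
  change fderiv ℝ (f ∘ rePi n) z _ = _
  rw [((hf (rePi n z)).hasFDerivAt.comp z (rePi n).hasFDerivAt).fderiv,
    ContinuousLinearMap.comp_apply, rePi_frame_inl]

theorem fderiv_fderiv_apply_eq_sum {f : (Fin n → ℝ) → ℝ} (hf : ContDiff ℝ 2 f)
    (x v w : Fin n → ℝ) :
    fderiv ℝ (fun y => fderiv ℝ f y v) x w =
      ∑ b, ∑ d, fderiv ℝ (fun y => fderiv ℝ f y (Pi.single b 1)) x (Pi.single d 1) *
        v b * w d := by
  have hsum : ∀ v : Fin n → ℝ, v = ∑ b, v b • Pi.single b (1 : ℝ) := fun v => by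
    simpa using (pi_eq_sum_univ' v)
  have hv : (fun y => fderiv ℝ f y v) =
      fun y => ∑ b, v b * fderiv ℝ f y (Pi.single b 1) := by
    funext y
    conv_lhs => rw [hsum v, map_sum]
    simp
  have hd := fun b : Fin n => differentiable_fderiv_apply hf (Pi.single b (1 : ℝ))
  rw [hv, fderiv_fun_sum fun b _ => ((hd b).const_mul (v b)) x, _root_.sum_apply]
  refine Finset.sum_congr rfl fun b _ => ?_
  rw [fderiv_const_mul (hd b x), _root_.smul_apply]
  conv_lhs => rw [hsum w, map_sum]
  simp only [map_smul, smul_eq_mul, Finset.mul_sum]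
  exact Finset.sum_congr rfl fun d _ => by ring

variable (g) in
/-- The Hessian of `log det g(∂x_j, ∂x_k)` on the base `ℝⁿ`. -/
def hessian (x v w : Fin n → ℝ) : ℝ :=
  fderiv ℝ (fun y => fderiv ℝ g.baseLogDet y v) x w

theorem ricci_eq_hessian (hK : g.IsKahler) (hH : g.IsHamiltonian) (z v w : Fin n → ℂ) :
    g.ricci z v w = -(1 / 2) * (g.hessian (rePi n z) (fun j => (v j).re) (fun j => (w j).re) +
      g.hessian (rePi n z) (fun j => (v j).im) (fun j => (w j).im)) := by
  have h2 := g.contDiff_baseLogDet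
  have h : ∀ b d, partialDeriv (Sum.inl d) (partialDeriv (Sum.inl b) g.logDet) z =
      fderiv ℝ (fun y => fderiv ℝ g.baseLogDet y (Pi.single b 1)) (rePi n z) (Pi.single d 1) :=
    fun b d => by
      rw [logDet_eq_baseLogDet hH, partialDeriv_inl_comp_rePi (h2.differentiable (by norm_num)),
        partialDeriv_inl_comp_rePi (differentiable_fderiv_apply h2 _)]
  rw [ricci_eq_logDet hK hH, hessian, hessian,
    fderiv_fderiv_apply_eq_sum h2 _ fun j => (v j).re,
    fderiv_fderiv_apply_eq_sum h2 _ fun j => (v j).im]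
  simp only [h]

theorem ricciNonpos_iff (hK : g.IsKahler) (hH : g.IsHamiltonian) :
    g.RicciNonpos ↔ ∀ x v, 0 ≤ g.hessian x v v := by
  constructor
  · intro h x v
    have := h (ofRealPi n x) (ofRealPi n v)
    rw [ricci_eq_hessian hK hH] at this
    simp only [ofRealPi_apply, Complex.ofReal_re, Complex.ofReal_im] at this
    have h0 : ∀ x, g.hessian x (fun _ => 0) (fun _ => 0) = 0 := fun x => map_zero (fderiv ℝ _ x)
    rw [h0] at this
    change -(1 / 2) * (g.hessian x v v + 0) ≤ 0 at this
    linarith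
  · intro h z v
    rw [ricci_eq_hessian hK hH]
    linarith [h (rePi n z) fun j => (v j).re, h (rePi n z) fun j => (v j).im]

theorem ricciNonneg_iff (hK : g.IsKahler) (hH : g.IsHamiltonian) :
    g.RicciNonneg ↔ ∀ x v, g.hessian x v v ≤ 0 := by
  constructor
  · intro h x v
    have := h (ofRealPi n x) (ofRealPi n v)
    rw [ricci_eq_hessian hK hH] at this
    simp only [ofRealPi_apply, Complex.ofReal_re, Complex.ofReal_im] at this
    have h0 : ∀ x, g.hessian x (fun _ => 0) (fun _ => 0) = 0 := fun x => map_zero (fderiv ℝ _ x)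
    rw [h0] at this
    change 0 ≤ -(1 / 2) * (g.hessian x v v + 0) at this
    linarith
  · intro h z v
    rw [ricci_eq_hessian hK hH]
    linarith [h (rePi n z) fun j => (v j).re, h (rePi n z) fun j => (v j).im]

theorem hessian_eq_zero_of_ricciFlat (hK : g.IsKahler) (hH : g.IsHamiltonian)
    (h : g.RicciFlat) (x v w : Fin n → ℝ) : g.hessian x v w = 0 := by
  have := h (ofRealPi n x) (ofRealPi n v) (ofRealPi n w)
  rw [ricci_eq_hessian hK hH] at this
  simp only [ofRealPi_apply, Complex.ofReal_re, Complex.ofReal_im] at this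
  have h0 : ∀ x, g.hessian x (fun _ => 0) (fun _ => 0) = 0 := fun x => map_zero (fderiv ℝ _ x)
  rw [h0] at this
  change -(1 / 2) * (g.hessian x v w + 0) = 0 at this
  linarith

theorem torusVolume_eq (hK : g.IsKahler) (hH : g.IsHamiltonian) (x : Fin n → ℝ) :
    g.torusVolume x = (2 * Real.pi) ^ n * Real.sqrt (g.baseGram (ofRealPi n x)).det := by
  have hconst : ∀ y : Fin n → ℝ,
      (of fun j k : Fin n =>
        g.inner ((fun l => (x l : ℂ) + (y l : ℂ) * Complex.I : Fin n → ℂ) : M n)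
          (frame (Sum.inr j)) (frame (Sum.inr k))) = g.baseGram (ofRealPi n x) := fun y => by
    ext j k
    rw [of_apply, ← I_smul_frame_inl, ← I_smul_frame_inl, hK.hermitian]
    refine (eq_comp_rePi ((g.contDiff_baseGram j k).differentiable (by simp))
      (fun a => partialDeriv_inr_baseGram hH j k a) _).trans ?_
    congr 2
    ext l
    simp
  have hvol : (MeasureTheory.volume.real
      (Set.Icc (0 : Fin n → ℝ) fun _ => 2 * Real.pi)) = (2 * Real.pi) ^ n := by
    rw [MeasureTheory.measureReal_def, Real.volume_Icc_pi_toReal (fun _ => by positivity)]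
    simp
  simp only [torusVolume, hconst, MeasureTheory.setIntegral_const, hvol, smul_eq_mul]

theorem log_torusVolume (hK : g.IsKahler) (hH : g.IsHamiltonian) :
    (fun x => Real.log (g.torusVolume x)) =
      fun x => n * Real.log (2 * Real.pi) + (1 / 2) * g.baseLogDet x := by
  funext x
  have hd := g.det_baseGram_pos (ofRealPi n x)
  rw [torusVolume_eq hK hH, Real.log_mul (by positivity) (by positivity), Real.log_pow,
    Real.log_sqrt hd.le, baseLogDet, logDet]
  ring

theorem torusVolume_pos (hK : g.IsKahler) (hH : g.IsHamiltonian) (x : Fin n → ℝ) :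
    0 < g.torusVolume x := by
  have hd := g.det_baseGram_pos (ofRealPi n x)
  rw [torusVolume_eq hK hH]
  positivity

theorem contDiff_log_torusVolume (hK : g.IsKahler) (hH : g.IsHamiltonian) :
    ContDiff ℝ 2 fun x => Real.log (g.torusVolume x) := by
  rw [log_torusVolume hK hH]
  exact contDiff_const.add (contDiff_const.mul g.contDiff_baseLogDet)

theorem fderiv_fderiv_log_torusVolume (hK : g.IsKahler) (hH : g.IsHamiltonian)
    (x v w : Fin n → ℝ) :
    fderiv ℝ (fun y => fderiv ℝ (fun x => Real.log (g.torusVolume x)) y v) x w =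
      (1 / 2) * g.hessian x v w := by
  have h2 := g.contDiff_baseLogDet
  have hd : Differentiable ℝ g.baseLogDet := h2.differentiable (by norm_num)
  have h1 : (fun y => fderiv ℝ (fun x => Real.log (g.torusVolume x)) y v) =
      fun y => (1 / 2) * fderiv ℝ g.baseLogDet y v := by
    funext y
    rw [log_torusVolume hK hH, fderiv_const_add, fderiv_const_mul (hd y)]
    rfl
  rw [h1, fderiv_const_mul (differentiable_fderiv_apply h2 v x)]
  rfl

theorem ricciNonpos_iff_convexOn (hK : g.IsKahler) (hH : g.IsHamiltonian) :
    g.RicciNonpos ↔ ConvexOn ℝ Set.univ fun x : Fin n → ℝ => Real.log (g.torusVolume x) := by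
  rw [ricciNonpos_iff hK hH,
    convexOn_univ_iff_fderiv_fderiv_nonneg (contDiff_log_torusVolume hK hH)]
  simp [fderiv_fderiv_log_torusVolume hK hH]

theorem ricciNonneg_iff_concaveOn (hK : g.IsKahler) (hH : g.IsHamiltonian) :
    g.RicciNonneg ↔ ConcaveOn ℝ Set.univ fun x : Fin n → ℝ => Real.log (g.torusVolume x) := by
  rw [ricciNonneg_iff hK hH,
    concaveOn_univ_iff_fderiv_fderiv_nonpos (contDiff_log_torusVolume hK hH)]
  refine forall₂_congr fun x v => ?_
  rw [fderiv_fderiv_log_torusVolume hK hH]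
  constructor <;> intro h <;> linarith

end TorusVolume

end RiemannianMetric

end KahlerTorus

theorem ConvexOn.exp_comp {E : Type*} [AddCommGroup E] [Module ℝ E] {f : E → ℝ}
    (hf : ConvexOn ℝ Set.univ f) : ConvexOn ℝ Set.univ fun x => Real.exp (f x) := by
  refine ⟨convex_univ, fun x hx y hy a b ha hb hab => ?_⟩
  exact (Real.exp_le_exp.2 (hf.2 hx hy ha hb hab)).trans
    (convexOn_exp.2 (Set.mem_univ _) (Set.mem_univ _) ha hb hab)

end

theorem mainTheorem2 (n : ℕ) (g : KahlerTorus.RiemannianMetric n)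
    (hKahler : g.IsKahler) (hHam : g.IsHamiltonian) :
    ((g.RicciNonpos ↔ ConvexOn ℝ Set.univ fun x : Fin n → ℝ => Real.log (g.torusVolume x)) ∧
      (g.RicciNonpos → ConvexOn ℝ Set.univ g.torusVolume)) ∧
    ((g.RicciNonneg ↔ ConcaveOn ℝ Set.univ fun x : Fin n → ℝ => Real.log (g.torusVolume x)) ∧
      (g.RicciNonneg → ConvexOn ℝ Set.univ fun x : Fin n → ℝ => 1 / g.torusVolume x)) ∧
    (g.RicciFlat → ∃ (L : (Fin n → ℝ) →ₗ[ℝ] ℝ) (c : ℝ),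
      ∀ x : Fin n → ℝ, Real.log (g.torusVolume x) = L x + c) := by
  have hpos := KahlerTorus.RiemannianMetric.torusVolume_pos hKahler hHam
  have hconvex := KahlerTorus.RiemannianMetric.ricciNonpos_iff_convexOn hKahler hHam
  have hconcave := KahlerTorus.RiemannianMetric.ricciNonneg_iff_concaveOn hKahler hHam
  refine ⟨⟨hconvex, fun h => ?_⟩, ⟨hconcave, fun h => ?_⟩, fun h => ?_⟩
  · have := (hconvex.1 h).exp_comp
    simpa only [Real.exp_log (hpos _)] using this
  · have := (hconcave.1 h).neg.exp_comp
    simpa only [Pi.neg_apply, Real.exp_neg, Real.exp_log (hpos _), one_div] using this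
  · refine exists_linear_add_const_of_fderiv_fderiv_eq_zero
      (KahlerTorus.RiemannianMetric.contDiff_log_torusVolume hKahler hHam) fun x v w => ?_
    rw [KahlerTorus.RiemannianMetric.fderiv_fderiv_log_torusVolume hKahler hHam,
      KahlerTorus.RiemannianMetric.hessian_eq_zero_of_ricciFlat hKahler hHam h, mul_zero]
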